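/- Theorem 4.2. Let $f,g:\mathbb{R}^n\to\mathbb{R}\cup\{\infty\}$ be closed, proper and convex functions, where closed means that the epigraph is closed and proper means finite at some point. Let $f^*(y)=\sup_{x}\{y^Tx-f(x)\}$ denote the conjugate of $f$, and consider the primal problem $$\text{(P)}\quad \text{minimize}_{x\in\mathbb{R}^n}\ f(x)+g(x)$$ and the dual problem $$\text{(D)}\quad \text{maximize}_{\nu\in\mathbb{R}^n}\ -f^*(\nu)-g^*(-\nu),$$ with optimal values $p^\star=\inf_x\{f(x)+g(x)\}$ and $d^\star=\sup_\nu\{-f^*(\nu)-g^*(-\nu)\}$. For $\gamma>0$ and $z^0\in\mathbb{R}^n$ let the Douglas–Rachford splitting (DRS) iterates be defined for $k=0,1,2,\dots$ by $$x^{k+1/2}=\mathrm{Prox}_{\gamma f}(z^k),\qquad x^{k+1}=\mathrm{Prox}_{\gamma g}(2x^{k+1/2}-z^k),\qquad z^{k+1}=z^k+x^{k+1}-x^{k+1/2},$$ where $\mathrm{Prox}_h(z)=\mathrm{argmin}_{x\in\mathbb{R}^n}\{h(x)+\tfrac12\|x-z\|_2^2\}$. Suppose that $d^\star=p^\star$ is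 finite, that (P) has a solution, and that (D) has no solution. Then, for every $\gamma>0$ and every $z^0\in\mathbb{R}^n$, $x^{k+1}-x^{k+1/2}\to 0$, $$\lim_{k\to\infty}\frac{1}{k+1}\sum_{i=0}^{k}\left(f(x^{i+1/2})+g(x^{i+1})\right)=p^\star,\qquad \liminf_{k\to\infty}\left(f(x^{k+1/2})+g(x^{k+1})\right)=p^\star .$$ Furthermore, for every $x^\star\in\mathbb{R}^n$, $x^{k+1/2}\to x^\star$ if and only if $x^{k+1}\to x^\star$, and in that case $x^\star$ is a solution of (P). -/

import Mathlib

open Filter Topology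

namespace DRS

/-- Extended-real-valued functions on `ℝⁿ` (Euclidean norm). Functions with values in
`ℝ ∪ {∞}` are those that never take the value `⊥`, which is required in `CPC`. -/
abbrev ExtFun (n : ℕ) := EuclideanSpace ℝ (Fin n) → EReal

/-- Closed, proper and convex functions `f : ℝⁿ → ℝ ∪ {∞}`. -/
structure CPC {n : ℕ} (f : ExtFun n) : Prop where
  /-- `f` takes values in `ℝ ∪ {∞}` -/
  ne_bot : ∀ x, f x ≠ ⊥
  /-- `f` is finite somewhere -/
  proper : ∃ x, f x < ⊤
  /-- Jensen's inequality; in `EReal` one has `0 * ⊤ = 0` -/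
  convex : ∀ x y : EuclideanSpace ℝ (Fin n), ∀ θ : ℝ, 0 ≤ θ → θ ≤ 1 →
    f (θ • x + (1 - θ) • y) ≤ (θ : EReal) * f x + ((1 - θ : ℝ) : EReal) * f y
  /-- the epigraph is a closed subset of `ℝⁿ × ℝ` -/
  closed : IsClosed {p : EuclideanSpace ℝ (Fin n) × ℝ | f p.1 ≤ (p.2 : EReal)}

/-- The effective domain. -/
def dom {n : ℕ} (f : ExtFun n) : Set (EuclideanSpace ℝ (Fin n)) := {x | f x < ⊤}

/-- The conjugate `f*(y) = sup_x (⟨y, x⟩ - f x)`. -/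
noncomputable def conj {n : ℕ} (f : ExtFun n) : ExtFun n :=
  fun y => ⨆ x, ((inner ℝ y x : ℝ) : EReal) - f x

/-- The primal optimal value `p* = inf_x (f x + g x)`. -/
noncomputable def primalValue {n : ℕ} (f g : ExtFun n) : EReal := ⨅ x, f x + g x

/-- The dual optimal value `d* = sup_ν (-f*(ν) - g*(-ν))`. -/
noncomputable def dualValue {n : ℕ} (f g : ExtFun n) : EReal :=
  ⨆ ν, -conj f ν - conj g (-ν)

/-- `x` is a solution of the primal problem: a feasible point attaining `p*`. -/
def IsPrimalSolution {n : ℕ} (f g : ExtFun n) (x : EuclideanSpace ℝ (Fin n)) : Prop :=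
  x ∈ dom f ∧ x ∈ dom g ∧ f x + g x = primalValue f g

/-- `ν` is a solution of the dual problem: a feasible point attaining `d*`. -/
def IsDualSolution {n : ℕ} (f g : ExtFun n) (ν : EuclideanSpace ℝ (Fin n)) : Prop :=
  ν ∈ dom (conj f) ∧ -ν ∈ dom (conj g) ∧ -conj f ν - conj g (-ν) = dualValue f g

/-- `p` minimizes `x ↦ f x + (1/2) ‖x - z‖²` over `ℝⁿ`. -/
def IsProx {n : ℕ} (f : ExtFun n) (z p : EuclideanSpace ℝ (Fin n)) : Prop :=
  ∀ x, f p + ((1 / 2 * ‖p - z‖ ^ 2 : ℝ) : EReal) ≤ f x + ((1 / 2 * ‖x - z‖ ^ 2 : ℝ) : EReal)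

/-- The proximal operator `Prox_f(z) = argmin_x (f x + (1/2) ‖x - z‖²)`. For closed, proper and
convex `f` there is exactly one minimizer; the value is arbitrary if there is none. -/
noncomputable def prox {n : ℕ} (f : ExtFun n) (z : EuclideanSpace ℝ (Fin n)) :
    EuclideanSpace ℝ (Fin n) :=
  Classical.epsilon (IsProx f z)

/-- `Prox_{γ f}`. -/
noncomputable def proxScaled {n : ℕ} (γ : ℝ) (f : ExtFun n) (z : EuclideanSpace ℝ (Fin n)) :
    EuclideanSpace ℝ (Fin n) :=
  prox (fun x => (γ : EReal) * f x) z

/-- The Douglas-Rachford main iterates `z^k` with parameter `γ` and starting point `z0`. -/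
noncomputable def mainIter {n : ℕ} (γ : ℝ) (f g : ExtFun n) (z0 : EuclideanSpace ℝ (Fin n)) :
    ℕ → EuclideanSpace ℝ (Fin n)
  | 0 => z0
  | k + 1 =>
    mainIter γ f g z0 k
      + proxScaled γ g
          ((2 : ℝ) • proxScaled γ f (mainIter γ f g z0 k) - mainIter γ f g z0 k)
      - proxScaled γ f (mainIter γ f g z0 k)

/-- `halfIter γ f g z0 k` is the shadow iterate `x^{k+1/2} = Prox_{γ f}(z^k)`. -/
noncomputable def halfIter {n : ℕ} (γ : ℝ) (f g : ExtFun n) (z0 : EuclideanSpace ℝ (Fin n))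
    (k : ℕ) : EuclideanSpace ℝ (Fin n) :=
  proxScaled γ f (mainIter γ f g z0 k)

/-- `fullIter γ f g z0 k` is the shadow iterate `x^{k+1} = Prox_{γ g}(2 x^{k+1/2} - z^k)`. -/
noncomputable def fullIter {n : ℕ} (γ : ℝ) (f g : ExtFun n) (z0 : EuclideanSpace ℝ (Fin n))
    (k : ℕ) : EuclideanSpace ℝ (Fin n) :=
  proxScaled γ g ((2 : ℝ) • halfIter γ f g z0 k - mainIter γ f g z0 k)

/-- The function value `f(x^{k+1/2}) + g(x^{k+1})`. -/
noncomputable def iterValue {n : ℕ} (γ : ℝ) (f g : ExtFun n) (z0 : EuclideanSpace ℝ (Fin n))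
    (k : ℕ) : EReal :=
  f (halfIter γ f g z0 k) + g (fullIter γ f g z0 k)

end DRS

/-!
Write `z, u, w` for the main and the two shadow iterates, `d = w - u` for the step of `z`, and `v`
for the value `f u + g w`. The optimality conditions of the two proximal points give subgradients
of `f` at `u` and of `g` at `w`. Adding the two subgradient inequalities at a primal solution `x`
yields the descent inequality (`iter_descent`)

  `2 γ (v_k - p) ≤ ‖z_k - x‖² - ‖z_{k+1} - x‖² - ‖d_k‖²`,

because the inner products telescope (`inner_add_inner_eq_telescope`). The same identity, applied
to differences of consecutive iterates and combined with monotonicity of subdifferentials, shows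
that `‖d_k‖` is nonincreasing (`antitone_norm_mainIter_diff`).

From below, the Fenchel-Young inequality gives `v_k ≥ D(ν) - ⟪ν, d_k⟫` for each dual feasible `ν`,
where `D(ν)` is its dual value. Inserted in the descent inequality, this makes `‖z_k - (x + γ ν)‖²`
decrease by `‖d_k‖²` up to an error `2 γ (p - D(ν))`. Summation and monotonicity of `‖d_k‖` bound
`limsup ‖d_k‖²` by `2 γ (p - D(ν))`, and since there is no duality gap, `d_k → 0`
(`tendsto_diff_of_descent`).

Now `d_k → 0` and the lower bound give `liminf v_k ≥ p`, while the summed descent inequality bounds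
the averages of `v` from above by `p + O(1 / k)`. Hence the averages converge to `p`, and
`liminf v_k = p`. Lower semicontinuity shows that a limit of the shadow iterates is a solution.

The existence of proximal points needs an affine minorant of `f` and of `g`; a dual feasible point
provides both.
-/

namespace DRS

/-! ### Proximal points -/

section Prox

variable {n : ℕ} {f : ExtFun n}

/-- Minimising `(x, t) ↦ γ t + ½ ‖x - z‖²` over the closed epigraph instead of the extended-valued
objective over the space keeps all quantities real. The affine minorant makes the sublevel sets
bounded. -/
lemma exists_isProx (hf : CPC f) {γ : ℝ} (hγ : 0 < γ) {ν : EuclideanSpace ℝ (Fin n)} {c : ℝ}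
    (hν : ∀ x, ((inner ℝ ν x - c : ℝ) : EReal) ≤ f x) (z : EuclideanSpace ℝ (Fin n)) :
    ∃ p, IsProx (fun x => (γ : EReal) * f x) z p := by
  obtain ⟨x₀, hx₀⟩ := hf.proper
  set t₀ := (f x₀).toReal
  have ht₀ : f x₀ = (t₀ : EReal) := (EReal.coe_toReal hx₀.ne (hf.ne_bot x₀)).symm
  set K := {q : EuclideanSpace ℝ (Fin n) × ℝ | f q.1 ≤ (q.2 : EReal)}
  set φ : EuclideanSpace ℝ (Fin n) × ℝ → ℝ := fun q => γ * q.2 + 1 / 2 * ‖q.1 - z‖ ^ 2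
  have hφ : Continuous φ := by fun_prop
  have hK : ∀ q ∈ K, inner ℝ ν q.1 - c ≤ q.2 := fun q hq =>
    EReal.coe_le_coe_iff.1 ((hν q.1).trans hq)
  set S := K ∩ {q | φ q ≤ φ (x₀, t₀)}
  have h0 : (x₀, t₀) ∈ S := ⟨ht₀.le, le_refl (φ (x₀, t₀))⟩
  have hSc : IsClosed S := hf.closed.inter (isClosed_le hφ continuous_const)
  set R := 2 * (φ (x₀, t₀) - γ * inner ℝ ν z + 1 / 2 * γ ^ 2 * ‖ν‖ ^ 2 + γ * c)
  have hball : ∀ q ∈ S, ‖q.1 - (z - γ • ν)‖ ^ 2 ≤ R := by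
    rintro ⟨x, t⟩ ⟨hq, hq'⟩
    have h1 : γ * (inner ℝ ν x - c) ≤ γ * t := mul_le_mul_of_nonneg_left (hK _ hq) hγ.le
    have h2 : γ * t + 1 / 2 * ‖x - z‖ ^ 2 ≤ φ (x₀, t₀) := hq'
    have h3 : ‖x - (z - γ • ν)‖ ^ 2
        = ‖x - z‖ ^ 2 + 2 * (γ * (inner ℝ ν x - inner ℝ ν z)) + γ ^ 2 * ‖ν‖ ^ 2 := by
      rw [show x - (z - γ • ν) = (x - z) + γ • ν by abel, norm_add_sq_real, inner_smul_right,
        real_inner_comm, inner_sub_right, norm_smul, mul_pow, Real.norm_eq_abs, sq_abs]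
    simp only [R]
    rw [h3]
    linarith
  have hS : IsCompact S := by
    refine Metric.isCompact_of_isClosed_isBounded hSc ?_
    have hB : IsCompact (Metric.closedBall (z - γ • ν) √R) := isCompact_closedBall _ _
    have hcont : Continuous fun x : EuclideanSpace ℝ (Fin n) => inner ℝ ν x - c := by fun_prop
    obtain ⟨m, hm'⟩ := hB.bddBelow_image hcont.continuousOn
    have hm : ∀ x ∈ Metric.closedBall (z - γ • ν) √R, m ≤ inner ℝ ν x - c := fun x hx =>
      hm' (Set.mem_image_of_mem _ hx)
    refine (hB.isBounded.prod (Metric.isBounded_Icc m (φ (x₀, t₀) / γ))).subset ?_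
    rintro ⟨x, t⟩ hq
    have hx : x ∈ Metric.closedBall (z - γ • ν) √R := by
      rw [mem_closedBall_iff_norm]
      exact Real.le_sqrt_of_sq_le (hball (x, t) hq)
    have h1 : inner ℝ ν x - c ≤ t := hK (x, t) hq.1
    have h2 : γ * t + 1 / 2 * ‖x - z‖ ^ 2 ≤ φ (x₀, t₀) := hq.2
    have h3 : t ≤ φ (x₀, t₀) / γ := by
      rw [le_div_iff₀ hγ]
      linarith [sq_nonneg ‖x - z‖]
    exact Set.mk_mem_prod hx ⟨(hm x hx).trans h1, h3⟩
  obtain ⟨⟨p, s⟩, hp, hmin⟩ := hS.exists_isMinOn ⟨_, h0⟩ hφ.continuousOn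
  refine ⟨p, fun x => ?_⟩
  rcases eq_or_ne (f x) ⊤ with hx | hx
  · beta_reduce
    rw [hx, EReal.coe_mul_top_of_pos hγ, EReal.top_add_coe]
    exact le_top
  have hxt : f x = ((f x).toReal : EReal) := (EReal.coe_toReal hx (hf.ne_bot x)).symm
  have key : φ (p, s) ≤ φ (x, (f x).toReal) := by
    by_cases h : φ (x, (f x).toReal) ≤ φ (x₀, t₀)
    · exact hmin ⟨hxt.le, h⟩
    · exact hp.2.trans (not_le.1 h).le
  have hps : f p ≤ (s : EReal) := hp.1
  calc (γ : EReal) * f p + ((1 / 2 * ‖p - z‖ ^ 2 : ℝ) : EReal)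
      ≤ (γ : EReal) * s + ((1 / 2 * ‖p - z‖ ^ 2 : ℝ) : EReal) := by
        gcongr
    _ = (φ (p, s) : EReal) := by push_cast [φ]; rfl
    _ ≤ (φ (x, (f x).toReal) : EReal) := by exact_mod_cast key
    _ = (γ : EReal) * f x + ((1 / 2 * ‖x - z‖ ^ 2 : ℝ) : EReal) := by
        rw [hxt]; simp only [φ, EReal.toReal_coe]; norm_cast

lemma IsProx.ne_top (hf : CPC f) {γ : ℝ} (hγ : 0 < γ) {z p : EuclideanSpace ℝ (Fin n)}
    (h : IsProx (fun x => (γ : EReal) * f x) z p) : f p ≠ ⊤ := by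
  intro hp
  obtain ⟨x₀, hx₀⟩ := hf.proper
  have h1 := h x₀
  beta_reduce at h1
  rw [← EReal.coe_toReal hx₀.ne (hf.ne_bot x₀), hp, EReal.coe_mul_top_of_pos hγ,
    EReal.top_add_coe, top_le_iff] at h1
  exact EReal.coe_ne_top _ (by exact_mod_cast h1)

/-- Optimality condition: `(z - p) / γ` is a subgradient of `f` at `p = Prox_{γ f}(z)`. -/
lemma IsProx.inner_le (hf : CPC f) {γ : ℝ} (hγ : 0 < γ) {z p x : EuclideanSpace ℝ (Fin n)}
    (h : IsProx (fun x => (γ : EReal) * f x) z p) (hx : f x ≠ ⊤) :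
    inner ℝ (z - p) (x - p) ≤ γ * ((f x).toReal - (f p).toReal) := by
  have hfp : f p = ((f p).toReal : EReal) :=
    (EReal.coe_toReal (h.ne_top hf hγ) (hf.ne_bot p)).symm
  have hfx : f x = ((f x).toReal : EReal) := (EReal.coe_toReal hx (hf.ne_bot x)).symm
  set a := (f p).toReal
  set b := (f x).toReal
  -- Compare `p` with the points `θ x + (1 - θ) p` and let `θ → 0`.
  have key : ∀ θ : ℝ, 0 < θ → θ ≤ 1 →
      inner ℝ (z - p) (x - p) ≤ γ * (b - a) + θ * (1 / 2 * ‖x - p‖ ^ 2) := by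
    intro θ h0 h1
    have hc := hf.convex x p θ h0.le h1
    have hm := h (θ • x + (1 - θ) • p)
    set y := θ • x + (1 - θ) • p with hy
    have hyb : f y ≤ ((θ * b + (1 - θ) * a : ℝ) : EReal) := by
      rw [hfx, hfp] at hc; exact_mod_cast hc
    have hm' : ((γ * a + 1 / 2 * ‖p - z‖ ^ 2 : ℝ) : EReal)
        ≤ ((γ * (θ * b + (1 - θ) * a) + 1 / 2 * ‖y - z‖ ^ 2 : ℝ) : EReal) := by
      calc ((γ * a + 1 / 2 * ‖p - z‖ ^ 2 : ℝ) : EReal)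
          = (γ : EReal) * f p + ((1 / 2 * ‖p - z‖ ^ 2 : ℝ) : EReal) := by rw [hfp]; norm_cast
        _ ≤ (γ : EReal) * f y + ((1 / 2 * ‖y - z‖ ^ 2 : ℝ) : EReal) := hm
        _ ≤ (γ : EReal) * ((θ * b + (1 - θ) * a : ℝ) : EReal)
              + ((1 / 2 * ‖y - z‖ ^ 2 : ℝ) : EReal) := by
            gcongr
        _ = _ := by norm_cast
    have hr := EReal.coe_le_coe_iff.1 hm'
    have hn : ‖y - z‖ ^ 2
        = ‖p - z‖ ^ 2 - 2 * (θ * inner ℝ (z - p) (x - p)) + θ ^ 2 * ‖x - p‖ ^ 2 := by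
      rw [show y - z = (p - z) + θ • (x - p) by rw [hy]; module, norm_add_sq_real,
        inner_smul_right, norm_smul, mul_pow, Real.norm_eq_abs, sq_abs,
        ← neg_sub z p, inner_neg_left]
      ring
    rw [hn] at hr
    refine le_of_mul_le_mul_left ?_ h0
    nlinarith
  have hlim : Tendsto (fun θ : ℝ => γ * (b - a) + θ * (1 / 2 * ‖x - p‖ ^ 2)) (𝓝[>] 0)
      (𝓝 (γ * (b - a) + 0 * (1 / 2 * ‖x - p‖ ^ 2))) :=
    (Continuous.tendsto (by fun_prop) 0).mono_left nhdsWithin_le_nhds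
  rw [zero_mul, add_zero] at hlim
  refine ge_of_tendsto hlim ?_
  filter_upwards [Ioc_mem_nhdsGT (zero_lt_one' ℝ)] with θ hθ using key θ hθ.1 hθ.2

/-- Monotonicity of the subdifferential, in terms of proximal points. -/
lemma IsProx.inner_sub_nonneg (hf : CPC f) {γ : ℝ} (hγ : 0 < γ)
    {z z' p p' : EuclideanSpace ℝ (Fin n)} (h : IsProx (fun x => (γ : EReal) * f x) z p)
    (h' : IsProx (fun x => (γ : EReal) * f x) z' p') :
    0 ≤ inner ℝ ((z - p) - (z' - p')) (p - p') := by
  have h1 := h.inner_le hf hγ (h'.ne_top hf hγ)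
  have h2 := h'.inner_le hf hγ (h.ne_top hf hγ)
  rw [← neg_sub p p', inner_neg_right] at h1
  rw [inner_sub_left]
  linarith

/-- The epigraph being closed makes `f` lower semicontinuous. -/
lemma CPC.lowerSemicontinuous (hf : CPC f) : LowerSemicontinuous f := by
  refine lowerSemicontinuous_iff_isClosed_preimage.2 fun y => ?_
  have hcoe : ∀ r : ℝ, IsClosed (f ⁻¹' Set.Iic (r : EReal)) := fun r =>
    hf.closed.preimage (f := fun x => (x, r)) (by fun_prop)
  induction y with
  | bot =>
    convert isClosed_empty
    ext x
    simp [hf.ne_bot x]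
  | coe r => exact hcoe r
  | top => simp

end Prox

/-! ### Weak duality -/

section Duality

variable {n : ℕ} {f g : ExtFun n}

lemma CPC.conj_ne_bot (hf : CPC f) (ν : EuclideanSpace ℝ (Fin n)) : conj f ν ≠ ⊥ := by
  obtain ⟨x₀, hx₀⟩ := hf.proper
  intro h
  have h1 : ((inner ℝ ν x₀ : ℝ) : EReal) - f x₀ ≤ conj f ν :=
    le_iSup (fun x => ((inner ℝ ν x : ℝ) : EReal) - f x) x₀
  rw [h, le_bot_iff, ← EReal.coe_toReal hx₀.ne (hf.ne_bot x₀)] at h1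
  norm_cast at h1

/-- Fenchel-Young inequality. -/
lemma CPC.inner_sub_conj_le (hf : CPC f) {ν : EuclideanSpace ℝ (Fin n)} (hν : conj f ν ≠ ⊤)
    (x : EuclideanSpace ℝ (Fin n)) :
    ((inner ℝ ν x - (conj f ν).toReal : ℝ) : EReal) ≤ f x := by
  rcases eq_or_ne (f x) ⊤ with hx | hx
  · simp [hx]
  have h1 : ((inner ℝ ν x : ℝ) : EReal) - f x ≤ conj f ν :=
    le_iSup (fun x => ((inner ℝ ν x : ℝ) : EReal) - f x) x
  rw [← EReal.coe_toReal hx (hf.ne_bot x), ← EReal.coe_toReal hν (hf.conj_ne_bot ν),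
    ← EReal.coe_sub, EReal.coe_le_coe_iff] at h1
  rw [← EReal.coe_toReal hx (hf.ne_bot x), EReal.coe_le_coe_iff]
  linarith

/-- Any real number below the dual value is exceeded at some dual feasible point. -/
lemma exists_lt_dual (hf : CPC f) (hg : CPC g) {r : ℝ} (hr : (r : EReal) < dualValue f g) :
    ∃ ν, conj f ν ≠ ⊤ ∧ conj g (-ν) ≠ ⊤ ∧ r < -(conj f ν).toReal - (conj g (-ν)).toReal := by
  obtain ⟨ν, hν⟩ := lt_iSup_iff.1 hr
  have h1 : conj f ν ≠ ⊤ := by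
    intro h
    simp [h, sub_eq_add_neg] at hν
  have h2 : conj g (-ν) ≠ ⊤ := by
    intro h
    simp [h, sub_eq_add_neg] at hν
  refine ⟨ν, h1, h2, ?_⟩
  rw [← EReal.coe_toReal h1 (hf.conj_ne_bot ν), ← EReal.coe_toReal h2 (hg.conj_ne_bot _)] at hν
  exact_mod_cast hν

end Duality

/-! ### The Douglas-Rachford inequality -/

/-- With `u`, `u + d` the two shadow iterates obtained from `z`, the subgradient terms collapse to
a telescoping difference; the successor of `z` is `z + d`. -/
lemma inner_add_inner_eq_telescope {E : Type*} [NormedAddCommGroup E] [InnerProductSpace ℝ E]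
    (z u d x : E) :
    inner ℝ (z - u) (u - x) + inner ℝ ((u - z) - d) (u + d - x)
      = -(1 / 2) * (‖z + d - x‖ ^ 2 - ‖z - x‖ ^ 2 + ‖d‖ ^ 2) := by
  rw [show z + d - x = (z - x) + d by abel, norm_add_sq_real,
    show u + d - x = (u - x) + d by abel, show z - u = (z - x) - (u - x) by abel,
    show u - z - d = (u - x) - (z - x) - d by abel]
  simp only [inner_sub_left, inner_add_right, inner_sub_right, real_inner_self_eq_norm_sq,
    real_inner_comm]
  simp only [real_inner_comm d, real_inner_comm x u, real_inner_comm x z, norm_sub_sq_real]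
  ring_nf

lemma norm_sub_add_smul_sq_sub {E : Type*} [NormedAddCommGroup E] [InnerProductSpace ℝ E]
    (z z' x ν : E) (γ : ℝ) :
    ‖z' - (x + γ • ν)‖ ^ 2 - ‖z - (x + γ • ν)‖ ^ 2
      = ‖z' - x‖ ^ 2 - ‖z - x‖ ^ 2 - 2 * γ * inner ℝ ν (z' - z) := by
  rw [← sub_sub z', ← sub_sub z, norm_sub_sq_real (z' - x), norm_sub_sq_real (z - x),
    inner_smul_right, inner_smul_right, show z' - z = (z' - x) - (z - x) by abel,
    inner_sub_right ν, real_inner_comm ν (z' - x), real_inner_comm ν (z - x)]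
  ring

section Sequences

variable {E : Type*} [NormedAddCommGroup E] [InnerProductSpace ℝ E] {z : ℕ → E} {v : ℕ → ℝ}
  {p γ : ℝ} {x : E}

/-- A lower bound on `v` by an `ε`-optimal `ν` turns the descent inequality relative to `x` into a
near-descent inequality relative to `x + γ ν`, with error `2 γ ε` at each step. -/
lemma tendsto_diff_of_descent (hγ : 0 < γ)
    (hdesc : ∀ k, γ * (v k - p)
      ≤ -(1 / 2) * (‖z (k + 1) - x‖ ^ 2 - ‖z k - x‖ ^ 2 + ‖z (k + 1) - z k‖ ^ 2))
    (hdual : ∀ ε > 0, ∃ ν : E, ∀ k, p - ε - inner ℝ ν (z (k + 1) - z k) ≤ v k)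
    (hanti : Antitone fun k => ‖z (k + 1) - z k‖) :
    Tendsto (fun k => z (k + 1) - z k) atTop (𝓝 0) := by
  have hbound : ∀ ε > 0, ∃ C : ℝ, ∀ N : ℕ,
      N * ‖z (N + 1) - z N‖ ^ 2 ≤ C + N * (2 * γ * ε) := by
    intro ε hε
    obtain ⟨ν, hν⟩ := hdual ε hε
    set y := x + γ • ν with hy
    have hstep : ∀ k, ‖z (k + 1) - z k‖ ^ 2 + ‖z (k + 1) - y‖ ^ 2
        ≤ ‖z k - y‖ ^ 2 + 2 * γ * ε := by
      intro k
      have h1 := norm_sub_add_smul_sq_sub (z k) (z (k + 1)) x ν γ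
      have h2 := mul_le_mul_of_nonneg_left (hν k) hγ.le
      have h3 := hdesc k
      rw [← hy] at h1
      linarith
    have hsum : ∀ N : ℕ, N * ‖z (N + 1) - z N‖ ^ 2 + ‖z N - y‖ ^ 2
        ≤ ‖z 0 - y‖ ^ 2 + N * (2 * γ * ε) := by
      intro N
      induction N with
      | zero => simp
      | succ N ih =>
        have h1 : ‖z (N + 1 + 1) - z (N + 1)‖ ^ 2 ≤ ‖z (N + 1) - z N‖ ^ 2 :=
          pow_le_pow_left₀ (norm_nonneg _) (hanti N.le_succ) 2
        have h2 := mul_le_mul_of_nonneg_left h1 (Nat.cast_nonneg (α := ℝ) (N + 1))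
        have h3 := hstep N
        push_cast at h2 ⊢
        linarith
    exact ⟨‖z 0 - y‖ ^ 2, fun N => by linarith [hsum N, sq_nonneg ‖z N - y‖]⟩
  have hsq : Tendsto (fun k => ‖z (k + 1) - z k‖ ^ 2) atTop (𝓝 0) := by
    refine tendsto_order.2 ⟨fun a ha => Eventually.of_forall fun k =>
      ha.trans_le (sq_nonneg _), fun a ha => ?_⟩
    obtain ⟨C, hC⟩ := hbound (a / (4 * γ)) (by positivity)
    filter_upwards [eventually_gt_atTop 0,
      (tendsto_natCast_atTop_atTop (R := ℝ)).eventually_gt_atTop (C / (a / 2))] with N hN0 hN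
    have hN0' : (0 : ℝ) < N := by exact_mod_cast hN0
    have h1 := hC N
    rw [div_lt_iff₀ (by positivity)] at hN
    rw [show 2 * γ * (a / (4 * γ)) = a / 2 by field_simp; ring] at h1
    refine lt_of_mul_lt_mul_left ?_ hN0'.le
    linarith
  rw [tendsto_zero_iff_norm_tendsto_zero]
  simpa [Real.sqrt_sq] using hsq.sqrt

omit [InnerProductSpace ℝ E] in
lemma average_le_of_descent (hγ : 0 < γ)
    (hdesc : ∀ k, γ * (v k - p)
      ≤ -(1 / 2) * (‖z (k + 1) - x‖ ^ 2 - ‖z k - x‖ ^ 2 + ‖z (k + 1) - z k‖ ^ 2)) {N : ℕ}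
    (hN : N ≠ 0) :
    (N : ℝ)⁻¹ * ∑ i ∈ Finset.range N, v i ≤ p + (N : ℝ)⁻¹ * (‖z 0 - x‖ ^ 2 / (2 * γ)) := by
  have hsum : ∀ N : ℕ, γ * (∑ i ∈ Finset.range N, v i - N * p)
      ≤ 1 / 2 * (‖z 0 - x‖ ^ 2 - ‖z N - x‖ ^ 2) := by
    intro N
    induction N with
    | zero => simp
    | succ N ih =>
      rw [Finset.sum_range_succ]
      push_cast
      have := hdesc N
      nlinarith [sq_nonneg ‖z (N + 1) - z N‖]
  have h1 : ∑ i ∈ Finset.range N, v i - N * p ≤ ‖z 0 - x‖ ^ 2 / (2 * γ) := by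
    rw [le_div_iff₀ (by positivity)]
    linarith [hsum N, sq_nonneg ‖z N - x‖]
  rw [show p = (N : ℝ)⁻¹ * (N * p) by field_simp, ← mul_add]
  exact mul_le_mul_of_nonneg_left (by linarith) (by positivity)

/-- Cesàro means of a sequence eventually above `q` are eventually above any `r < q`. -/
lemma eventually_lt_average {q r : ℝ} (hr : r < q) (hv : ∀ᶠ k in atTop, q ≤ v k) :
    ∀ᶠ N : ℕ in atTop, r < (N : ℝ)⁻¹ * ∑ i ∈ Finset.range N, v i := by
  have h1 : Tendsto (fun k => min (v k) q) atTop (𝓝 q) :=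
    tendsto_const_nhds.congr' (hv.mono fun k hk => (min_eq_right hk).symm)
  filter_upwards [h1.cesaro.eventually (lt_mem_nhds hr)] with N hN
  exact hN.trans_le (mul_le_mul_of_nonneg_left
    (Finset.sum_le_sum fun i _ => min_le_left _ _) (by positivity))

omit [InnerProductSpace ℝ E] in
lemma tendsto_average_of_descent (hγ : 0 < γ)
    (hdesc : ∀ k, γ * (v k - p)
      ≤ -(1 / 2) * (‖z (k + 1) - x‖ ^ 2 - ‖z k - x‖ ^ 2 + ‖z (k + 1) - z k‖ ^ 2))
    (hlow : ∀ q < p, ∀ᶠ k in atTop, q ≤ v k) :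
    Tendsto (fun N : ℕ => (N : ℝ)⁻¹ * ∑ i ∈ Finset.range N, v i) atTop (𝓝 p) := by
  refine tendsto_order.2 ⟨fun a ha => ?_, fun a ha => ?_⟩
  · obtain ⟨q, haq, hqp⟩ := exists_between ha
    exact eventually_lt_average haq (hlow q hqp)
  · have h1 : Tendsto (fun N : ℕ => p + (N : ℝ)⁻¹ * (‖z 0 - x‖ ^ 2 / (2 * γ))) atTop (𝓝 p) := by
      simpa using (tendsto_inv_atTop_nhds_zero_nat (𝕜 := ℝ)).mul_const
        (‖z 0 - x‖ ^ 2 / (2 * γ)) |>.const_add p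
    filter_upwards [h1.eventually (gt_mem_nhds ha), eventually_ne_atTop 0] with N hN hN0
    exact (average_le_of_descent hγ hdesc hN0).trans_lt hN

/-- If the values were eventually above some `q > p`, so would be their averages. -/
lemma liminf_eq_of_tendsto_average
    (havg : Tendsto (fun N : ℕ => (N : ℝ)⁻¹ * ∑ i ∈ Finset.range N, v i) atTop (𝓝 p))
    (hlow : ∀ q < p, ∀ᶠ k in atTop, q ≤ v k) :
    liminf (fun k => (v k : EReal)) atTop = p := by
  apply le_antisymm
  · by_contra! h
    obtain ⟨q, hpq, hq⟩ := EReal.exists_between_coe_real h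
    obtain ⟨r, hpr, hrq⟩ := exists_between (EReal.coe_lt_coe_iff.1 hpq)
    have hv : ∀ᶠ k in atTop, q ≤ v k :=
      (eventually_lt_of_lt_liminf hq).mono fun k hk => (EReal.coe_lt_coe_iff.1 hk).le
    exact (hpr.trans_le (ge_of_tendsto havg
      ((eventually_lt_average hrq hv).mono fun _ h => h.le))).false
  · refine EReal.ge_of_forall_gt_iff_ge.1 fun q hq => ?_
    refine le_liminf_of_le (by isBoundedDefault) ?_
    exact (hlow q (EReal.coe_lt_coe_iff.1 hq)).mono fun k hk => EReal.coe_le_coe_iff.2 hk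

end Sequences

/-! ### The iterates -/

lemma coe_sum (s : Finset ℕ) (v : ℕ → ℝ) :
    ∑ i ∈ s, (v i : EReal) = ((∑ i ∈ s, v i : ℝ) : EReal) := by
  induction s using Finset.cons_induction with
  | empty => simp
  | cons a s ha ih => rw [Finset.sum_cons, Finset.sum_cons, EReal.coe_add, ih]


section Iterates

variable {n : ℕ} {f g : ExtFun n} {γ : ℝ} {z0 : EuclideanSpace ℝ (Fin n)}

lemma mainIter_succ (k : ℕ) : mainIter γ f g z0 (k + 1)
    = mainIter γ f g z0 k + (fullIter γ f g z0 k - halfIter γ f g z0 k) := by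
  rw [← add_sub_assoc]
  rfl

lemma mainIter_diff (k : ℕ) : mainIter γ f g z0 (k + 1) - mainIter γ f g z0 k
    = fullIter γ f g z0 k - halfIter γ f g z0 k := by
  rw [mainIter_succ, add_sub_cancel_left]

/-- The affine minorants that make both proximal maps well defined come from a dual feasible
point. -/
lemma isProx_iterates (hf : CPC f) (hg : CPC g) (hγ : 0 < γ) (hd : dualValue f g ≠ ⊥) (k : ℕ) :
    IsProx (fun x => (γ : EReal) * f x) (mainIter γ f g z0 k) (halfIter γ f g z0 k) ∧
    IsProx (fun x => (γ : EReal) * g x)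
      ((2 : ℝ) • halfIter γ f g z0 k - mainIter γ f g z0 k) (fullIter γ f g z0 k) := by
  obtain ⟨r, -, hr⟩ := EReal.exists_between_coe_real (bot_lt_iff_ne_bot.2 hd)
  obtain ⟨ν, h1, h2, -⟩ := exists_lt_dual hf hg hr
  exact ⟨Classical.epsilon_spec (exists_isProx hf hγ (hf.inner_sub_conj_le h1) _),
    Classical.epsilon_spec (exists_isProx hg hγ (hg.inner_sub_conj_le h2) _)⟩

lemma two_smul_sub_sub_eq {E : Type*} [AddCommGroup E] [Module ℝ E] (z u w : E) :
    (2 : ℝ) • u - z - w = (u - z) - (w - u) := by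
  module

/-- Nonexpansiveness of the Douglas-Rachford operator along the orbit. -/
lemma antitone_norm_mainIter_diff (hf : CPC f) (hg : CPC g) (hγ : 0 < γ)
    (hd : dualValue f g ≠ ⊥) :
    Antitone fun k => ‖mainIter γ f g z0 (k + 1) - mainIter γ f g z0 k‖ := by
  refine antitone_nat_of_succ_le fun k => ?_
  obtain ⟨hu, hw⟩ := isProx_iterates (z0 := z0) hf hg hγ hd k
  obtain ⟨hu', hw'⟩ := isProx_iterates (z0 := z0) hf hg hγ hd (k + 1)
  have h1 := hu'.inner_sub_nonneg hf hγ hu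
  have h2 := hw'.inner_sub_nonneg hg hγ hw
  rw [mainIter_succ (k + 1), mainIter_succ k]
  have hz := mainIter_succ (γ := γ) (f := f) (g := g) (z0 := z0) k
  set z := mainIter γ f g z0 k
  set z' := mainIter γ f g z0 (k + 1)
  set u := halfIter γ f g z0 k
  set u' := halfIter γ f g z0 (k + 1)
  set w := fullIter γ f g z0 k
  set w' := fullIter γ f g z0 (k + 1)
  -- The telescoping identity is applied to the differences of consecutive iterates.
  have h3 := inner_add_inner_eq_telescope (z' - z) (u' - u) ((w' - u') - (w - u)) 0
  rw [show (z' - z) - (u' - u) = (z' - u') - (z - u) by abel,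
    show (u' - u) - (z' - z) - ((w' - u') - (w - u))
      = ((2 : ℝ) • u' - z' - w') - ((2 : ℝ) • u - z - w) by module,
    show (u' - u) + ((w' - u') - (w - u)) - 0 = w' - w by abel, sub_zero, sub_zero, sub_zero,
    show z' - z = w - u by rw [hz]; abel,
    show (w - u) + ((w' - u') - (w - u)) = w' - u' by abel] at h3
  have h4 : ‖w' - u'‖ ≤ ‖w - u‖ := by
    refine pow_le_pow_iff_left₀ (norm_nonneg _) (norm_nonneg _) two_ne_zero |>.1 ?_
    nlinarith [sq_nonneg ‖(w' - u') - (w - u)‖]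
  rwa [add_sub_cancel_left, add_sub_cancel_left]

/-- Adding the subgradient inequalities at the two shadow iterates. -/
lemma iter_descent (hf : CPC f) (hg : CPC g) (hγ : 0 < γ) (hd : dualValue f g ≠ ⊥)
    {x : EuclideanSpace ℝ (Fin n)} (hfx : f x ≠ ⊤) (hgx : g x ≠ ⊤) (k : ℕ) :
    γ * (((f (halfIter γ f g z0 k)).toReal + (g (fullIter γ f g z0 k)).toReal)
        - ((f x).toReal + (g x).toReal))
      ≤ -(1 / 2) * (‖mainIter γ f g z0 (k + 1) - x‖ ^ 2 - ‖mainIter γ f g z0 k - x‖ ^ 2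
          + ‖mainIter γ f g z0 (k + 1) - mainIter γ f g z0 k‖ ^ 2) := by
  obtain ⟨hu, hw⟩ := isProx_iterates (z0 := z0) hf hg hγ hd k
  have h1 := hu.inner_le hf hγ hfx
  have h2 := hw.inner_le hg hγ hgx
  rw [mainIter_diff, mainIter_succ]
  set z := mainIter γ f g z0 k
  set u := halfIter γ f g z0 k
  set w := fullIter γ f g z0 k
  have h3 := inner_add_inner_eq_telescope z u (w - u) x
  rw [← two_smul_sub_sub_eq, show u + (w - u) - x = w - x by abel] at h3
  rw [← neg_sub u x, inner_neg_right] at h1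
  rw [← neg_sub w x, inner_neg_right] at h2
  linarith

/-- Weak duality along the iterates: adding the Fenchel-Young inequalities at the two shadow
iterates. -/
lemma le_iter_value (hf : CPC f) (hg : CPC g) (hγ : 0 < γ) (hd : dualValue f g ≠ ⊥)
    {ν : EuclideanSpace ℝ (Fin n)} (h1 : conj f ν ≠ ⊤) (h2 : conj g (-ν) ≠ ⊤) (k : ℕ) :
    -(conj f ν).toReal - (conj g (-ν)).toReal
        - inner ℝ ν (mainIter γ f g z0 (k + 1) - mainIter γ f g z0 k)
      ≤ (f (halfIter γ f g z0 k)).toReal + (g (fullIter γ f g z0 k)).toReal := by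
  obtain ⟨hu, hw⟩ := isProx_iterates (z0 := z0) hf hg hγ hd k
  have h3 := hf.inner_sub_conj_le h1 (halfIter γ f g z0 k)
  have h4 := hg.inner_sub_conj_le h2 (fullIter γ f g z0 k)
  rw [← EReal.coe_toReal (hu.ne_top hf hγ) (hf.ne_bot _), EReal.coe_le_coe_iff] at h3
  rw [← EReal.coe_toReal (hw.ne_top hg hγ) (hg.ne_bot _), EReal.coe_le_coe_iff] at h4
  rw [mainIter_diff, inner_sub_right]
  rw [inner_neg_left] at h4
  linarith

lemma iterValue_eq_coe (hf : CPC f) (hg : CPC g) (hγ : 0 < γ) (hd : dualValue f g ≠ ⊥) (k : ℕ) :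
    iterValue γ f g z0 k = (((f (halfIter γ f g z0 k)).toReal
      + (g (fullIter γ f g z0 k)).toReal : ℝ) : EReal) := by
  obtain ⟨hu, hw⟩ := isProx_iterates (z0 := z0) hf hg hγ hd k
  rw [EReal.coe_add, EReal.coe_toReal (hu.ne_top hf hγ) (hf.ne_bot _),
    EReal.coe_toReal (hw.ne_top hg hγ) (hg.ne_bot _)]
  rfl

end Iterates

/-- A common limit of two sequences attaining the primal value in the limit inferior solves the
primal problem. -/
lemma isPrimalSolution_of_tendsto {n : ℕ} {f g : ExtFun n} (hf : CPC f) (hg : CPC g)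
    (hp : primalValue f g ≠ ⊤) {u w : ℕ → EuclideanSpace ℝ (Fin n)}
    {x : EuclideanSpace ℝ (Fin n)} (hu : Tendsto u atTop (𝓝 x)) (hw : Tendsto w atTop (𝓝 x))
    (hlim : liminf (fun k => f (u k) + g (w k)) atTop = primalValue f g) :
    IsPrimalSolution f g x := by
  have hle : f x + g x ≤ primalValue f g := by
    rw [← hlim]
    refine le_of_forall_lt fun a ha => ?_
    have hprod : LowerSemicontinuous fun q : EuclideanSpace ℝ (Fin n) × EuclideanSpace ℝ (Fin n) =>
        f q.1 + g q.2 :=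
      (hf.lowerSemicontinuous.comp continuous_fst).add' (hg.lowerSemicontinuous.comp continuous_snd)
        fun q => EReal.continuousAt_add (Or.inr (hg.ne_bot _)) (Or.inl (hf.ne_bot _))
    obtain ⟨b, hab, hb⟩ := exists_between ha
    refine hab.trans_le (le_liminf_of_le (by isBoundedDefault) ?_)
    exact ((hu.prodMk_nhds hw).eventually (hprod (x, x) b hb)).mono fun k hk => hk.le
  have hlt : f x + g x < ⊤ := hle.trans_lt (lt_top_iff_ne_top.2 hp)
  have heq : f x + g x = primalValue f g := le_antisymm hle (iInf_le (fun x => f x + g x) x)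
  refine ⟨Ne.lt_top (a := f x) fun h => ?_, Ne.lt_top (a := g x) fun h => ?_, heq⟩
  · rw [h, EReal.top_add_of_ne_bot (hg.ne_bot x)] at hlt
    exact hlt.false
  · rw [h, EReal.add_top_of_ne_bot (hf.ne_bot x)] at hlt
    exact hlt.false

end DRS

theorem theorem4p2 (n : ℕ) (f g : DRS.ExtFun n) (hf : DRS.CPC f) (hg : DRS.CPC g)
    (γ : ℝ) (hγ : 0 < γ) (z0 : EuclideanSpace ℝ (Fin n))
    (h_strong : DRS.dualValue f g = DRS.primalValue f g)
    (h_ne_bot : DRS.primalValue f g ≠ ⊥) (h_ne_top : DRS.primalValue f g ≠ ⊤)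
    (h_primal : ∃ x, DRS.IsPrimalSolution f g x)
    (h_dual : ¬ ∃ ν, DRS.IsDualSolution f g ν) :
    Tendsto (fun k => DRS.fullIter γ f g z0 k - DRS.halfIter γ f g z0 k) atTop (𝓝 0) ∧
    Tendsto (fun k : ℕ =>
        (((1 : ℝ) / ((k : ℝ) + 1) : ℝ) : EReal) *
          ∑ i ∈ Finset.range (k + 1), DRS.iterValue γ f g z0 i)
      atTop (𝓝 (DRS.primalValue f g)) ∧
    liminf (fun k => DRS.iterValue γ f g z0 k) atTop = DRS.primalValue f g ∧
    ∀ xs : EuclideanSpace ℝ (Fin n),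
      (Tendsto (DRS.halfIter γ f g z0) atTop (𝓝 xs) ↔
        Tendsto (DRS.fullIter γ f g z0) atTop (𝓝 xs)) ∧
      (Tendsto (DRS.halfIter γ f g z0) atTop (𝓝 xs) → DRS.IsPrimalSolution f g xs) := by
  obtain ⟨x, hxf, hxg, hxp⟩ := h_primal
  have hd : DRS.dualValue f g ≠ ⊥ := h_strong ▸ h_ne_bot
  set v : ℕ → ℝ := fun k =>
    (f (DRS.halfIter γ f g z0 k)).toReal + (g (DRS.fullIter γ f g z0 k)).toReal with hv_def
  have hv : ∀ k, DRS.iterValue γ f g z0 k = (v k : EReal) := DRS.iterValue_eq_coe hf hg hγ hd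
  set p : ℝ := (f x).toReal + (g x).toReal with hp_def
  have hp : DRS.primalValue f g = (p : EReal) := by
    rw [← hxp, hp_def, EReal.coe_add, EReal.coe_toReal hxf.ne (hf.ne_bot x),
      EReal.coe_toReal hxg.ne (hg.ne_bot x)]
  have hdesc := DRS.iter_descent (z0 := z0) hf hg hγ hd hxf.ne hxg.ne
  have hdual : ∀ ε > 0, ∃ ν, ∀ k, p - ε
      - inner ℝ ν (DRS.mainIter γ f g z0 (k + 1) - DRS.mainIter γ f g z0 k) ≤ v k := by
    intro ε hε
    have hlt : ((p - ε : ℝ) : EReal) < DRS.dualValue f g := by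
      rw [h_strong, hp, EReal.coe_lt_coe_iff]
      linarith
    obtain ⟨ν, h1, h2, h3⟩ := DRS.exists_lt_dual hf hg hlt
    exact ⟨ν, fun k => by linarith [DRS.le_iter_value (z0 := z0) hf hg hγ hd h1 h2 k]⟩
  have hdiff := DRS.tendsto_diff_of_descent hγ hdesc hdual
    (DRS.antitone_norm_mainIter_diff hf hg hγ hd)
  have hlow : ∀ q < p, ∀ᶠ k in atTop, q ≤ v k := by
    intro q hq
    obtain ⟨ν, hν⟩ := hdual ((p - q) / 2) (by linarith)
    have h1 := (tendsto_const_nhds (x := ν)).inner (𝕜 := ℝ) hdiff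
    rw [inner_zero_right] at h1
    filter_upwards [h1.eventually (gt_mem_nhds (show 0 < (p - q) / 2 by linarith))] with k hk
    linarith [hν k]
  have havg := DRS.tendsto_average_of_descent hγ hdesc hlow
  have hliminf : liminf (fun k => DRS.iterValue γ f g z0 k) atTop = DRS.primalValue f g := by
    simp_rw [hv, hp]
    exact DRS.liminf_eq_of_tendsto_average havg hlow
  have hgap : Tendsto (fun k => DRS.fullIter γ f g z0 k - DRS.halfIter γ f g z0 k) atTop (𝓝 0) := by
    simpa only [DRS.mainIter_diff] using hdiff
  refine ⟨hgap, ?_, hliminf, fun xs => ?_⟩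
  · rw [hp]
    simp only [hv]
    refine ((continuous_coe_real_ereal.tendsto p).comp
      (havg.comp (tendsto_add_atTop_nat 1))).congr fun k => ?_
    simp only [Function.comp_apply]
    rw [EReal.coe_mul, ← DRS.coe_sum, one_div, Nat.cast_add, Nat.cast_one]
  · have hiff : Tendsto (DRS.halfIter γ f g z0) atTop (𝓝 xs) ↔
        Tendsto (DRS.fullIter γ f g z0) atTop (𝓝 xs) := by
      constructor
      · intro h
        simpa using h.add hgap
      · intro h
        simpa using h.sub hgap
    exact ⟨hiff, fun h => DRS.isPrimalSolution_of_tendsto hf hg h_ne_top h (hiff.1 h) hliminf⟩
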